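/- Let $s\ge 2$ and $k\ge 3$ be integers and let $\mathcal X$ be a family of $s$-edge colourings of $K_k$, i.e. a set of maps $\sigma:\binom{[k]}{2}\to[s]$. An $s$-edge colouring $\chi:E(G)\to[s]$ of a graph $G$ (not necessarily proper) is called $\mathcal X$-free if for no $\sigma\in\mathcal X$ is there an injection $\psi:[k]\to V(G)$ such that, for all $ij\in\binom{[k]}{2}$, $\psi(i)\psi(j)\in E(G)$ and $\chi(\psi(i)\psi(j))=\sigma(ij)$. Let $F(G;\mathcal X)$ be the number of $\mathcal X$-free $s$-edge colourings of $G$, and let $F(n;\mathcal X)$ be the maximum of $F(G;\mathcal X)$ over all graphs $G$ on $n$ vertices. Consider all triples $(r,\phi,\alpha)$ where $r\in\mathbb N$, $\phi:\binom{[r]}{2}\to 2^{[s]}$ is such that for no $\sigma\in\mathcal X$ is there an injection $\psi:[k]\to[r]$ with $\sigma(ij)\in\phi(\psi(i)\psi(j))$ for all $ij\in\binom{[k]}{2}$, and $\alpha=(\alpha_1,\dots,\alpha_r)$ is a vector of non-negative reals with $\sum_{i}\alpha_i=1$. Let $$q(\phi,\alpha)=2\sum_{ij\in\binom{[r]}{2}}\alpha_i\alpha_j\log|\phi(ij)|,\qquad\text{where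 }\log 0:=0.$$ Let $\mathrm{OPT}(\mathcal X)$ be the set of those triples at which $q$ attains its maximum over all such triples (this set may be empty), and let $Q(\mathcal X)$ be the supremum of $q$ over all such triples, which is the maximum when $\mathrm{OPT}(\mathcal X)\neq\emptyset$. If $\mathrm{OPT}(\mathcal X)\ne\emptyset$, then $$F(n;\mathcal X)=e^{Q(\mathcal X)\binom n2+o(n^2)}\qquad(n\to\infty).$$ -/

import Mathlib

namespace GenER

open Finset

noncomputable section

/-- A family of `s`-edge colourings of `K_k`; the colours are the elements of `Fin s`. -/
abbrev Family (k s : ℕ) := Set (SimpleGraph.TopEdgeLabeling (Fin k) (Fin s))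

/-- The edge colouring `χ` of `G` contains a copy of `σ`: some injection of the vertices of `K_k`
into the vertices of `G` sends every edge `ij` of `K_k` to an edge of `G` of colour `σ(ij)`. -/
def ContainsCopy {k s : ℕ} {V : Type*} {G : SimpleGraph V}
    (χ : G.EdgeLabeling (Fin s)) (σ : SimpleGraph.TopEdgeLabeling (Fin k) (Fin s)) : Prop :=
  ∃ ψ : Fin k ↪ V, ∀ (i j : Fin k) (hij : i ≠ j),
    ∃ h : G.Adj (ψ i) (ψ j), χ.get (ψ i) (ψ j) h = σ.get i j hij

/-- `χ` contains no coloured copy of `K_k` lying in `X`. -/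
def IsFree {k s : ℕ} (X : Family k s) {V : Type*} {G : SimpleGraph V}
    (χ : G.EdgeLabeling (Fin s)) : Prop :=
  ∀ σ ∈ X, ¬ ContainsCopy χ σ

/-- `F(G; X)`: the number of `X`-free `s`-edge colourings of `G`. -/
def numFree {k s : ℕ} (X : Family k s) {V : Type*} (G : SimpleGraph V) : ℕ :=
  Nat.card {χ : G.EdgeLabeling (Fin s) // IsFree X χ}

/-- `F(n; X)`: the maximum of `F(G; X)` over all graphs `G` on `n` vertices. -/
def maxFree {k s : ℕ} (X : Family k s) (n : ℕ) : ℕ :=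
  (univ : Finset (SimpleGraph (Fin n))).sup' univ_nonempty (fun G => numFree X G)

/-- A map `φ` from the pairs of elements of `[r]` to sets of colours. -/
abbrev SetColouring (r s : ℕ) := SimpleGraph.TopEdgeLabeling (Fin r) (Finset (Fin s))

/-- `φ` is `σ`-free: there is no injective `ψ : [k] → [r]` with `σ(ij) ∈ φ(ψ(i)ψ(j))` for all
pairs `ij`. -/
def SetColouring.IsFreeOf {k s r : ℕ} (φ : SetColouring r s)
    (σ : SimpleGraph.TopEdgeLabeling (Fin k) (Fin s)) : Prop :=
  ¬ ∃ ψ : Fin k ↪ Fin r, ∀ (i j : Fin k) (hij : i ≠ j),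
    σ.get i j hij ∈ φ.get (ψ i) (ψ j) (ψ.injective.ne hij)

/-- `Φ_{X,t}(r)`: the `X`-free maps `φ` all of whose multiplicities `|φ(ij)|` are at least `t`. -/
def templates {k s : ℕ} (X : Family k s) (t r : ℕ) : Set (SetColouring r s) :=
  {φ | (∀ σ ∈ X, φ.IsFreeOf σ) ∧ ∀ (i j : Fin r) (hij : i ≠ j), t ≤ (φ.get i j hij).card}

/-- A triple `(r, φ, α)`. -/
structure Triple (s : ℕ) where
  r : ℕ
  φ : SetColouring r s
  α : Fin r → ℝ

/-- The objective `q(φ, α) = 2 ∑ α_i α_j log |φ(ij)|`, the sum being over the unordered pairs `ij`.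
The convention `log 0 = 0` is that of `Real.log`. -/
def Triple.q {s : ℕ} (T : Triple s) : ℝ :=
  2 * ∑ i, ∑ j, if h : i < j then
    T.α i * T.α j * Real.log ((T.φ.get i j h.ne).card : ℝ) else 0

/-- The feasible triples of Problem `Q_t(X)`. -/
def feas {k s : ℕ} (X : Family k s) (t : ℕ) : Set (Triple s) :=
  {T | T.φ ∈ templates X t T.r ∧ T.α ∈ stdSimplex ℝ (Fin T.r)}

/-- The optimal triples of Problem `Q_t(X)`. -/
def opt {k s : ℕ} (X : Family k s) (t : ℕ) : Set (Triple s) :=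
  {T | T ∈ feas X t ∧ ∀ T' ∈ feas X t, T'.q ≤ T.q}

/-- The optimum value of Problem `Q_t(X)`. When `opt X t` is nonempty this supremum is attained
and is the maximum of the objective. -/
def optValue {k s : ℕ} (X : Family k s) (t : ℕ) : ℝ :=
  sSup (Triple.q '' feas X t)

end

end GenER

/-! Lower bound. Take an optimal triple and label the `n` vertices independently with distribution
`α`. The expected sum of `log |φ|` over pairs is exactly `q * n.choose 2`, so some labelling reaches
it (`exists_blowup`). Join the pairs whose colour set is nonempty: every choice of colours from
these sets is `X`-free, and the number of choices is the exponential of that sum.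

Upper bound. This is a container argument based on weak regularity. For a free colouring of `G`,
apply `weak_regularity` to the indicators of all colours simultaneously, and let the template of a
pair of parts be the set of colours of density above `δ`. Few edges have a colour outside the
template, and the counting lemma `sum_prod_le_of_cut_le` shows that the template has few copies of
members of `X`, since the colouring has none (`exists_template`). There are only `exp(O(n))` pairs
consisting of a labelling and a template.

It remains to bound the colourings near one template. Their number is governed by the sum of `log
|template|` over edges, the deviating edges costing little (`card_close_le`). That sum is controlled
by supersaturation (`sum_log_le_of_few_copies`): a random sample of `m` vertices usually induces an
`X`-free set colouring, which with uniform weights is a feasible triple, so its value is at most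
`Q`.

The attained optimum serves both sides: its triple is blown up below, and its value is the `Q` that
bounds all samples above. -/

namespace GenER

open Finset

noncomputable section

/-! ### Averages over the fibres of a map -/

section FiberAvg

variable {Ω ι : Type*} [Fintype Ω] [DecidableEq ι]

/-- The average of `f` over the fibre of `π` above `i` (zero if the fibre is empty). -/
def fiberAvg (π : Ω → ι) (f : Ω → ℝ) (i : ι) : ℝ :=
  (∑ ω with π ω = i, f ω) / (#{ω | π ω = i} : ℝ)

lemma fiberAvg_nonneg (π : Ω → ι) {f : Ω → ℝ} (hf : ∀ ω, 0 ≤ f ω) (i : ι) :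
    0 ≤ fiberAvg π f i :=
  div_nonneg (sum_nonneg fun ω _ => hf ω) (Nat.cast_nonneg _)

lemma fiberAvg_le_one (π : Ω → ι) {f : Ω → ℝ} (hf : ∀ ω, f ω ≤ 1) (i : ι) :
    fiberAvg π f i ≤ 1 := by
  refine div_le_one_of_le₀ ?_ (Nat.cast_nonneg _)
  refine (sum_le_sum fun ω _ => hf ω).trans ?_
  simp

lemma sum_fiberAvg_mul (π : Ω → ι) (f : Ω → ℝ) (g : ι → ℝ) :
    ∑ ω, fiberAvg π f (π ω) * g (π ω) = ∑ ω, f ω * g (π ω) := by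
  simp only [fiberAvg, div_mul_eq_mul_div, sum_div, sum_mul]
  simp only [sum_filter]
  rw [sum_comm]
  refine sum_congr rfl fun ω _ => ?_
  rw [← sum_filter]
  have h : ∀ ω' ∈ univ.filter (fun ω' => π ω = π ω'),
      f ω * g (π ω') / (#{ω'' | π ω'' = π ω'} : ℝ)
        = f ω * g (π ω) / (#{ω'' | π ω'' = π ω} : ℝ) := by
    intro ω' hω'
    rw [(mem_filter.1 hω').2]
  rw [sum_congr rfl h, sum_const, nsmul_eq_mul]
  have hc : #{ω' | π ω = π ω'} = #{ω' | π ω' = π ω} := by simp only [eq_comm]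
  have hpos : (0 : ℝ) < (#{ω' | π ω' = π ω} : ℝ) :=
    Nat.cast_pos.2 (card_pos.2 ⟨ω, by simp⟩)
  rw [hc]
  field_simp

/-- Pythagoras: the fibre average is the orthogonal projection of `f` onto the functions that factor
through `π`, hence the best such approximation in the square norm. -/
lemma sum_sq_sub_fiberAvg_le (π : Ω → ι) (f : Ω → ℝ) (g : ι → ℝ) :
    ∑ ω, (f ω - fiberAvg π f (π ω)) ^ 2 ≤ ∑ ω, (f ω - g (π ω)) ^ 2 := by
  have h := sum_fiberAvg_mul π f (fun i => fiberAvg π f i - g i)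
  have e : ∑ ω, (f ω - g (π ω)) ^ 2 = ∑ ω, (f ω - fiberAvg π f (π ω)) ^ 2
      + ∑ ω, (fiberAvg π f (π ω) - g (π ω)) ^ 2
      + 2 * (∑ ω, f ω * (fiberAvg π f (π ω) - g (π ω))
        - ∑ ω, fiberAvg π f (π ω) * (fiberAvg π f (π ω) - g (π ω))) := by
    rw [← sum_sub_distrib, mul_sum, ← sum_add_distrib, ← sum_add_distrib]
    exact sum_congr rfl fun ω _ => by ring
  rw [e, h, sub_self, mul_zero, add_zero]
  exact le_add_of_nonneg_right (sum_nonneg fun ω _ => sq_nonneg _)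

end FiberAvg

/-! ### Weak regularity -/

section WeakRegularity

variable {V : Type*} [Fintype V]

/-- The average of `f` over the cells of `V × V` given by the labelling `p` of `V`. -/
def blockAvg (p : V → ℕ) (f : V → V → ℝ) (a b : ℕ) : ℝ :=
  fiberAvg (fun z : V × V => (p z.1, p z.2)) (fun z => f z.1 z.2) (a, b)

/-- The squared distance from a system of functions to their averages. -/
def residual {s : ℕ} (f : Fin s → V → V → ℝ) (p : V → ℕ) : ℝ :=
  ∑ c, ∑ z : V × V, (f c z.1 z.2 - blockAvg p (f c) (p z.1) (p z.2)) ^ 2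

lemma blockAvg_mem_Icc (p : V → ℕ) {f : V → V → ℝ} (h0 : ∀ x y, 0 ≤ f x y)
    (h1 : ∀ x y, f x y ≤ 1) (a b : ℕ) : 0 ≤ blockAvg p f a b ∧ blockAvg p f a b ≤ 1 :=
  ⟨fiberAvg_nonneg _ (fun z : V × V => h0 z.1 z.2) _,
    fiberAvg_le_one _ (fun z : V × V => h1 z.1 z.2) _⟩

lemma blockAvg_comm (p : V → ℕ) {f : V → V → ℝ} (hf : ∀ x y, f x y = f y x) (a b : ℕ) :
    blockAvg p f a b = blockAvg p f b a := by
  have h1 : ∑ z : V × V with (p z.1, p z.2) = (a, b), f z.1 z.2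
      = ∑ z : V × V with (p z.1, p z.2) = (b, a), f z.1 z.2 := by
    refine sum_equiv (Equiv.prodComm V V) (fun z => ?_) (fun z _ => hf _ _)
    simp [and_comm]
  have h2 : #{z : V × V | (p z.1, p z.2) = (a, b)} = #{z : V × V | (p z.1, p z.2) = (b, a)} := by
    refine card_equiv (Equiv.prodComm V V) (fun z => ?_)
    simp [and_comm]
  simp only [blockAvg, fiberAvg, h1, h2]

lemma residual_nonneg {s : ℕ} (f : Fin s → V → V → ℝ) (p : V → ℕ) : 0 ≤ residual f p :=
  sum_nonneg fun _ _ => sum_nonneg fun _ _ => sq_nonneg _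

lemma residual_le {s : ℕ} {f : Fin s → V → V → ℝ} (h0 : ∀ c x y, 0 ≤ f c x y)
    (h1 : ∀ c x y, f c x y ≤ 1) (p : V → ℕ) :
    residual f p ≤ s * (Fintype.card V : ℝ) ^ 2 := by
  calc residual f p ≤ ∑ _c : Fin s, ∑ _z : V × V, (1 : ℝ) := by
        refine sum_le_sum fun c _ => sum_le_sum fun z _ => ?_
        have := blockAvg_mem_Icc p (h0 c) (h1 c) (p z.1) (p z.2)
        have a0 := h0 c z.1 z.2
        have a1 := h1 c z.1 z.2
        rw [sq_le_one_iff_abs_le_one, abs_le]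
        constructor <;> linarith
    _ = s * (Fintype.card V : ℝ) ^ 2 := by simp [sq]

/-- Energy decrement: a rectangle `A × B` on which the averages fail is added to the partition, and
correcting the old averages by `±ε` on it already gives a closer approximation of `f c`. Recording
membership in `A` and in `B` multiplies the number of labels by 4. -/
lemma residual_refine {s : ℕ} (f : Fin s → V → V → ℝ) (p : V → ℕ) {ε : ℝ} (hε : 0 ≤ ε)
    (c : Fin s) (A B : Finset V)
    (h : ε * (Fintype.card V : ℝ) ^ 2 <
      |∑ x ∈ A, ∑ y ∈ B, (f c x y - blockAvg p (f c) (p x) (p y))|) {K : ℕ}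
    (hp : ∀ x, p x < K) :
    ∃ p' : V → ℕ, (∀ x, p' x < 4 * K) ∧
      residual f p' ≤ residual f p - ε ^ 2 * (Fintype.card V : ℝ) ^ 2 := by
  classical
  set N := (Fintype.card V : ℝ) ^ 2 with hN
  set t := ∑ x ∈ A, ∑ y ∈ B, (f c x y - blockAvg p (f c) (p x) (p y)) with ht
  -- The old label and the two membership bits are packed into one number, from which `/ 4`, `% 4 /
  -- 2` and `% 2` recover them.
  let p' : V → ℕ := fun x => 4 * p x + (2 * (if x ∈ A then 1 else 0) + (if x ∈ B then 1 else 0))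
  have hdiv : ∀ x, p' x / 4 = p x := by intro x; simp only [p']; split_ifs <;> omega
  have hA : ∀ x, (p' x % 4 / 2 = 1 ↔ x ∈ A) := by
    intro x; simp only [p']; split_ifs <;> simp_all
  have hB : ∀ x, (p' x % 2 = 1 ↔ x ∈ B) := by
    intro x; simp only [p']; split_ifs <;> simp_all <;> omega
  refine ⟨p', fun x => ?_, ?_⟩
  · have := hp x
    simp only [p']; split_ifs <;> omega
  -- the sign with which the indicator of `A × B` is added
  obtain ⟨l, hl2, hlt⟩ : ∃ l : ℝ, l ^ 2 = ε ^ 2 ∧ ε ^ 2 * N ≤ l * t := by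
    rcases abs_cases t with ⟨e, _⟩ | ⟨e, _⟩
    · exact ⟨ε, rfl, by rw [e] at h; nlinarith⟩
    · exact ⟨-ε, by ring, by rw [e] at h; nlinarith⟩
  have key : ∀ d, ∑ z : V × V, (f d z.1 z.2 - blockAvg p' (f d) (p' z.1) (p' z.2)) ^ 2 ≤
      ∑ z : V × V, (f d z.1 z.2 - blockAvg p (f d) (p z.1) (p z.2)) ^ 2
        - (if d = c then ε ^ 2 * N else 0) := by
    intro d
    -- Competitor for the new averages. For `d = c` the square expands to the old one minus `2 * l *
    -- t` plus at most `ε ^ 2 * N`, a net gain of `ε ^ 2 * N`.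
    let g : ℕ × ℕ → ℝ := fun ab => blockAvg p (f d) (ab.1 / 4) (ab.2 / 4) +
      (if d = c then (if ab.1 % 4 / 2 = 1 ∧ ab.2 % 2 = 1 then l else 0) else 0)
    have h1 := sum_sq_sub_fiberAvg_le (fun z : V × V => (p' z.1, p' z.2))
      (fun z => f d z.1 z.2) g
    refine h1.trans ?_
    simp only [g, hdiv, hA, hB]
    split_ifs with hd
    · subst hd
      have e : ∀ z : V × V, (f d z.1 z.2 - (blockAvg p (f d) (p z.1) (p z.2) +
          if z.1 ∈ A ∧ z.2 ∈ B then l else 0)) ^ 2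
          = (f d z.1 z.2 - blockAvg p (f d) (p z.1) (p z.2)) ^ 2
            - 2 * l * (if z ∈ A ×ˢ B then f d z.1 z.2 - blockAvg p (f d) (p z.1) (p z.2) else 0)
            + (if z ∈ A ×ˢ B then l ^ 2 else 0) := by
        intro z
        simp only [mem_product]
        split_ifs <;> ring
      simp only [e, sum_add_distrib, sum_sub_distrib, ← mul_sum]
      rw [← sum_filter, ← sum_filter, filter_mem_eq_inter, univ_inter, sum_product, ← ht,
        sum_const, nsmul_eq_mul]
      have hcard : ((A ×ˢ B).card : ℝ) ≤ N := by
        have := card_le_univ (A ×ˢ B)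
        rw [Fintype.card_prod, ← sq] at this
        rw [hN]
        exact_mod_cast this
      have : ((A ×ˢ B).card : ℝ) * l ^ 2 ≤ N * ε ^ 2 := by
        rw [hl2]; exact mul_le_mul_of_nonneg_right hcard (sq_nonneg _)
      linarith
    · simp
  calc residual f p' ≤ ∑ d, (∑ z : V × V, (f d z.1 z.2 - blockAvg p (f d) (p z.1) (p z.2)) ^ 2
        - (if d = c then ε ^ 2 * N else 0)) := sum_le_sum fun d _ => key d
    _ = _ := by rw [sum_sub_distrib]; simp [residual]

/-- The weak regularity lemma of Frieze and Kannan, for several functions at once. -/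
theorem weak_regularity (s : ℕ) {ε : ℝ} (hε : 0 < ε) :
    ∃ M : ℕ, ∀ (V : Type) [Fintype V] (f : Fin s → V → V → ℝ), (∀ c x y, 0 ≤ f c x y) →
      (∀ c x y, f c x y ≤ 1) → ∃ p : V → ℕ, (∀ x, p x < M) ∧ ∀ c (A B : Finset V),
        |∑ x ∈ A, ∑ y ∈ B, (f c x y - blockAvg p (f c) (p x) (p y))| ≤
          ε * (Fintype.card V : ℝ) ^ 2 := by
  -- The residual starts at most `s * n ^ 2` and loses `ε ^ 2 * n ^ 2` per round, so `K` failing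
  -- rounds would make it negative.
  obtain ⟨K, hK⟩ := exists_nat_gt ((s : ℝ) / ε ^ 2)
  refine ⟨4 ^ K, fun V _ f h0 h1 => ?_⟩
  by_contra hcon
  push Not at hcon
  have step : ∀ j ≤ K, ∃ p : V → ℕ, (∀ x, p x < 4 ^ j) ∧
      residual f p ≤ (s - j * ε ^ 2) * (Fintype.card V : ℝ) ^ 2 := by
    intro j
    induction j with
    | zero => exact fun _ => ⟨fun _ => 0, by simp, by simpa using residual_le h0 h1 _⟩
    | succ j ih =>
      intro hj
      obtain ⟨p, hp, hr⟩ := ih (by omega)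
      obtain ⟨c, A, B, h⟩ := hcon p fun x =>
        (hp x).trans_le (Nat.pow_le_pow_right (by norm_num) (by omega))
      obtain ⟨p', hp', hr'⟩ := residual_refine f p hε.le c A B h hp
      refine ⟨p', fun x => by rw [pow_succ']; exact hp' x, hr'.trans ?_⟩
      push_cast
      linarith
  obtain ⟨p, hp, hr⟩ := step K le_rfl
  obtain ⟨c, A, B, h⟩ := hcon p hp
  rcases isEmpty_or_nonempty V with hV | hV
  · simp [Finset.eq_empty_of_isEmpty A] at h
  · have hN : (0 : ℝ) < (Fintype.card V : ℝ) ^ 2 := by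
      have : (0 : ℝ) < Fintype.card V := Nat.cast_pos.2 Fintype.card_pos
      positivity
    rw [div_lt_iff₀ (by positivity)] at hK
    have := residual_nonneg f p
    nlinarith

end WeakRegularity

/-! ### Resampling some coordinates -/

section Resample

variable {ι κ V : Type*}

lemma extend_extend_comp {ψ : ι → κ} (hψ : ψ.Injective) (x : ι → V) (y : κ → V) :
    Function.extend ψ (y ∘ ψ) (Function.extend ψ x y) = y := by
  funext l
  by_cases h : ∃ i, ψ i = l
  · obtain ⟨i, rfl⟩ := h
    rw [hψ.extend_apply, Function.comp_apply]
  · rw [Function.extend_apply' _ _ _ h, Function.extend_apply' _ _ _ h]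

lemma extend_comp_self {ψ : ι → κ} (hψ : ψ.Injective) (x : ι → V) (y : κ → V) :
    Function.extend ψ x y ∘ ψ = x :=
  funext fun i => hψ.extend_apply x y i

lemma injective_pair {i j : κ} (hij : i ≠ j) : Function.Injective (![i, j] : Fin 2 → κ) := by
  intro a b
  fin_cases a <;> fin_cases b <;> simp [hij, hij.symm]

/-- Exchanging the coordinates of `y` in the range of `ψ` with those of `x`. -/
def swapEquiv (V : Type*) (ψ : ι → κ) (hψ : ψ.Injective) :
    (κ → V) × (ι → V) ≃ (κ → V) × (ι → V) where
  toFun z := (Function.extend ψ z.2 z.1, z.1 ∘ ψ)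
  invFun z := (Function.extend ψ z.2 z.1, z.1 ∘ ψ)
  left_inv _ := Prod.ext (extend_extend_comp hψ _ _) (extend_comp_self hψ _ _)
  right_inv _ := Prod.ext (extend_extend_comp hψ _ _) (extend_comp_self hψ _ _)

variable [Fintype ι] [Fintype κ]

lemma prod_extend_mul_prod_comp (w : V → ℝ) {ψ : ι → κ} (hψ : ψ.Injective) (x : ι → V)
    (y : κ → V) :
    (∏ l, w (Function.extend ψ x y l)) * ∏ i, w (y (ψ i)) = (∏ l, w (y l)) * ∏ i, w (x i) := by
  classical
  have h1 : ∀ u : κ → V, ∏ l, w (u l)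
      = (∏ i, w (u (ψ i))) * ∏ l ∈ univ.filter (fun l => l ∉ univ.image ψ), w (u l) := by
    intro u
    rw [← prod_filter_mul_prod_filter_not univ (fun l => l ∈ univ.image ψ),
      filter_mem_eq_inter, univ_inter, prod_image hψ.injOn]
  rw [h1 (Function.extend ψ x y), h1 y]
  have h2 : ∏ l ∈ univ.filter (fun l => l ∉ univ.image ψ), w (Function.extend ψ x y l)
      = ∏ l ∈ univ.filter (fun l => l ∉ univ.image ψ), w (y l) := by
    refine prod_congr rfl fun l hl => ?_
    rw [Function.extend_apply' _ _ _ (by simpa using hl)]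
  simp only [h2, hψ.extend_apply]
  ring

variable [Fintype V] [DecidableEq ι] [DecidableEq κ]

lemma sum_prod_eq_pow (w : V → ℝ) : ∑ x : ι → V, ∏ i, w (x i) = (∑ v, w v) ^ Fintype.card ι := by
  have := prod_univ_sum (R := ℝ) (fun _ : ι => (univ : Finset V)) (fun _ v => w v)
  rw [Fintype.piFinset_univ] at this
  rw [← this, prod_const, card_univ]

/-- Under a product weight, redrawing the coordinates in the range of `ψ` does not change an
expectation: `swapEquiv` is a bijection that preserves the joint weight. -/
lemma sum_resample (w : V → ℝ) {ψ : ι → κ} (hψ : ψ.Injective) (g : (κ → V) → ℝ) :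
    (∑ v, w v) ^ Fintype.card ι * ∑ y : κ → V, (∏ l, w (y l)) * g y =
      ∑ y : κ → V, (∏ l, w (y l)) *
        ∑ x : ι → V, (∏ i, w (x i)) * g (Function.extend ψ x y) := by
  have h := (swapEquiv V ψ hψ).sum_comp
    (fun z => (∏ l, w (z.1 l)) * (∏ i, w (z.2 i)) * g z.1)
  simp only [swapEquiv, Equiv.coe_fn_mk, Function.comp_apply, prod_extend_mul_prod_comp w hψ] at h
  rw [Fintype.sum_prod_type, Fintype.sum_prod_type] at h
  rw [← sum_prod_eq_pow (ι := ι) w, mul_comm, sum_mul]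
  simp only [mul_sum]
  refine Eq.trans (sum_congr rfl fun y _ => sum_congr rfl fun x _ => ?_)
    (h.symm.trans (sum_congr rfl fun y _ => sum_congr rfl fun x _ => ?_)) <;> ring

/-- The marginal of a product weight on the coordinates in the range of `ψ` is again a product
weight. The powers of the total weight are the normalisation. -/
lemma sum_comp_embedding (w : V → ℝ) {ψ : ι → κ} (hψ : ψ.Injective) (g : (ι → V) → ℝ) :
    (∑ v, w v) ^ Fintype.card ι * ∑ y : κ → V, (∏ l, w (y l)) * g (y ∘ ψ) =
      (∑ v, w v) ^ Fintype.card κ * ∑ x : ι → V, (∏ i, w (x i)) * g x := by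
  rw [sum_resample w hψ (fun y => g (y ∘ ψ))]
  simp only [extend_comp_self hψ]
  rw [← sum_mul, sum_prod_eq_pow]

lemma sum_comp_embedding_card {ψ : ι → κ} (hψ : ψ.Injective) (g : (ι → V) → ℝ) :
    (Fintype.card V : ℝ) ^ Fintype.card ι * ∑ y : κ → V, g (y ∘ ψ) =
      (Fintype.card V : ℝ) ^ Fintype.card κ * ∑ x : ι → V, g x := by
  simpa using sum_comp_embedding (fun _ : V => (1 : ℝ)) hψ g

lemma sum_pair (g : V → V → ℝ) :
    ∑ x : Fin 2 → V, g (x 0) (x 1) = ∑ u, ∑ v, g u v := by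
  rw [← Fintype.sum_prod_type' g]
  exact Fintype.sum_equiv (finTwoArrowEquiv V) _ _ fun x => rfl

end Resample

/-! ### Counting -/

section Counting

variable {V : Type*}

lemma sum_mul_le_sum_filter (A : Finset V) (a c : V → ℝ) (h0 : ∀ x, 0 ≤ a x) (h1 : ∀ x, a x ≤ 1) :
    ∑ x ∈ A, a x * c x ≤ ∑ x ∈ A with 0 < c x, c x := by
  rw [sum_filter]
  refine sum_le_sum fun x _ => ?_
  split_ifs with h
  · exact mul_le_of_le_one_left h.le (h1 x)
  · exact mul_nonpos_of_nonneg_of_nonpos (h0 x) (not_lt.1 h)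

variable [Fintype V]

/-- A bilinear form is largest at 0-1 vectors: each of `a` and `b` in turn is replaced by the
indicator of the set where its coefficient is positive. -/
lemma bilinear_le_of_cut_le {D : V → V → ℝ} {B : ℝ}
    (hD : ∀ S T : Finset V, ∑ x ∈ S, ∑ y ∈ T, D x y ≤ B) {a b : V → ℝ}
    (ha0 : ∀ x, 0 ≤ a x) (ha1 : ∀ x, a x ≤ 1) (hb0 : ∀ x, 0 ≤ b x) (hb1 : ∀ x, b x ≤ 1) :
    ∑ x, ∑ y, D x y * (a x * b y) ≤ B := by
  have e : ∑ x, ∑ y, D x y * (a x * b y) = ∑ x, a x * ∑ y, D x y * b y := by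
    simp only [mul_sum]
    exact sum_congr rfl fun x _ => sum_congr rfl fun y _ => by ring
  rw [e]
  refine (sum_mul_le_sum_filter univ a _ ha0 ha1).trans ?_
  set S := univ.filter fun x => 0 < ∑ y, D x y * b y
  have e' : ∑ x ∈ S, ∑ y, D x y * b y = ∑ y, b y * ∑ x ∈ S, D x y := by
    rw [sum_comm]
    simp only [mul_sum]
    exact sum_congr rfl fun x _ => sum_congr rfl fun y _ => by ring
  rw [e']
  refine (sum_mul_le_sum_filter univ b _ hb0 hb1).trans ?_
  rw [sum_comm]
  exact hD _ _

/-- Once all coordinates other than `i` and `j` are frozen, `a` depends only on `x i` and `b` only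
on `x j`, so the bilinear cut bound applies to each frozen sum. -/
lemma sum_pair_mul_le [Nonempty V] {k : ℕ} {D : V → V → ℝ} {ε : ℝ}
    (hD : ∀ S T : Finset V, ∑ x ∈ S, ∑ y ∈ T, D x y ≤ ε * (Fintype.card V : ℝ) ^ 2)
    {i j : Fin k} (hij : i ≠ j) {a b : (Fin k → V) → ℝ}
    (ha : ∀ x x', (∀ l, l ≠ j → x l = x' l) → a x = a x')
    (hb : ∀ x x', (∀ l, l ≠ i → x l = x' l) → b x = b x')
    (ha0 : ∀ x, 0 ≤ a x) (ha1 : ∀ x, a x ≤ 1) (hb0 : ∀ x, 0 ≤ b x) (hb1 : ∀ x, b x ≤ 1) :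
    ∑ x : Fin k → V, D (x i) (x j) * (a x * b x) ≤ ε * (Fintype.card V : ℝ) ^ k := by
  have hψ := injective_pair hij
  have hn : (0 : ℝ) < (Fintype.card V : ℝ) ^ 2 :=
    pow_pos (Nat.cast_pos.2 Fintype.card_pos) 2
  have h := sum_resample (fun _ : V => (1 : ℝ)) hψ
    (fun x : Fin k → V => D (x i) (x j) * (a x * b x))
  simp only [prod_const_one, one_mul, sum_const, card_univ, nsmul_eq_mul, mul_one,
    Fintype.card_fin] at h
  refine le_of_mul_le_mul_left ?_ hn
  rw [h]
  have hy : ∀ y : Fin k → V, ∑ x : Fin 2 → V,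
      D (Function.extend ![i, j] x y i) (Function.extend ![i, j] x y j) *
        (a (Function.extend ![i, j] x y) * b (Function.extend ![i, j] x y))
      ≤ ε * (Fintype.card V : ℝ) ^ 2 := by
    intro y
    have hi : ∀ x : Fin 2 → V, Function.extend ![i, j] x y i = x 0 := fun x =>
      hψ.extend_apply x y 0
    have hj : ∀ x : Fin 2 → V, Function.extend ![i, j] x y j = x 1 := fun x =>
      hψ.extend_apply x y 1
    have hl : ∀ x : Fin 2 → V, ∀ l, l ≠ i → l ≠ j → Function.extend ![i, j] x y l = y l := by
      intro x l h1 h2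
      refine Function.extend_apply' _ _ _ ?_
      rintro ⟨m, hm⟩
      fin_cases m
      · exact h1 hm.symm
      · exact h2 hm.symm
    -- Filler for the coordinate that `a`, respectively `b`, does not see.
    let v0 : V := Classical.arbitrary V
    have ea : ∀ x : Fin 2 → V, a (Function.extend ![i, j] x y)
        = a (Function.extend ![i, j] ![x 0, v0] y) := by
      refine fun x => ha _ _ fun l hlj => ?_
      by_cases hli : l = i
      · rw [hli, hi, hi]; rfl
      · rw [hl _ l hli hlj, hl _ l hli hlj]
    have eb : ∀ x : Fin 2 → V, b (Function.extend ![i, j] x y)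
        = b (Function.extend ![i, j] ![v0, x 1] y) := by
      refine fun x => hb _ _ fun l hli => ?_
      by_cases hlj : l = j
      · rw [hlj, hj, hj]; rfl
      · rw [hl _ l hli hlj, hl _ l hli hlj]
    simp only [hi, hj]
    rw [sum_congr rfl fun x _ => by rw [ea x, eb x],
      sum_pair (fun u v => D u v * (a (Function.extend ![i, j] ![u, v0] y) *
        b (Function.extend ![i, j] ![v0, v] y)))]
    exact bilinear_le_of_cut_le hD (fun _ => ha0 _) (fun _ => ha1 _) (fun _ => hb0 _)
      (fun _ => hb1 _)
  refine (sum_le_sum fun y _ => hy y).trans ?_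
  simp only [sum_const, card_univ, nsmul_eq_mul, Fintype.card_fun, Fintype.card_fin]
  push_cast
  exact le_of_eq (by ring)

/-- The counting lemma: replacing functions by functions close to them in cut norm hardly changes
the number of homomorphisms. -/
theorem sum_prod_le_of_cut_le [Nonempty V] {k : ℕ} (P : Finset (Fin k × Fin k))
    (hP : ∀ e ∈ P, e.1 < e.2) {F W : Fin k × Fin k → V → V → ℝ} {ε : ℝ}
    (hF0 : ∀ e x y, 0 ≤ F e x y) (hF1 : ∀ e x y, F e x y ≤ 1)
    (hW0 : ∀ e x y, 0 ≤ W e x y) (hW1 : ∀ e x y, W e x y ≤ 1)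
    (hcut : ∀ e, ∀ S T : Finset V,
      ∑ x ∈ S, ∑ y ∈ T, (W e x y - F e x y) ≤ ε * (Fintype.card V : ℝ) ^ 2) :
    ∑ x : Fin k → V, ∏ e ∈ P, W e (x e.1) (x e.2) ≤
      ∑ x : Fin k → V, ∏ e ∈ P, F e (x e.1) (x e.2)
        + #P * (ε * (Fintype.card V : ℝ) ^ k) := by
  -- Hybrid argument: the factors `F e` are exchanged for `W e` one pair at a time, each exchange
  -- costing at most `ε * n ^ k`.
  let H : Finset (Fin k × Fin k) → Fin k × Fin k → V → V → ℝ := fun S e =>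
    if e ∈ S then W e else F e
  have hH0 : ∀ S e x y, 0 ≤ H S e x y := by
    intro S e x y; simp only [H]; split_ifs
    exacts [hW0 _ _ _, hF0 _ _ _]
  have hH1 : ∀ S e x y, H S e x y ≤ 1 := by
    intro S e x y; simp only [H]; split_ifs
    exacts [hW1 _ _ _, hF1 _ _ _]
  have main : ∀ S ⊆ P, ∑ x : Fin k → V, ∏ e ∈ P, H S e (x e.1) (x e.2) ≤
      ∑ x : Fin k → V, ∏ e ∈ P, F e (x e.1) (x e.2)
        + #S * (ε * (Fintype.card V : ℝ) ^ k) := by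
    intro S
    induction S using Finset.induction_on with
    | empty => intro _; simp [H]
    | insert e S heS ih =>
      intro hS
      have heP : e ∈ P := hS (mem_insert_self _ _)
      have hIH := ih ((subset_insert _ _).trans hS)
      -- The remaining pairs are split by whether they avoid `e.2`. Those that touch `e.2` avoid
      -- `e.1`, because the ordered pairs in `P` that meet both endpoints reduce to `e` itself.
      let a : (Fin k → V) → ℝ := fun x =>
        ∏ d ∈ (P.erase e).filter (fun d => d.1 ≠ e.2 ∧ d.2 ≠ e.2), H S d (x d.1) (x d.2)
      let b : (Fin k → V) → ℝ := fun x =>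
        ∏ d ∈ (P.erase e).filter (fun d => ¬ (d.1 ≠ e.2 ∧ d.2 ≠ e.2)), H S d (x d.1) (x d.2)
      have split : ∀ x : Fin k → V, ∏ d ∈ P, H (insert e S) d (x d.1) (x d.2)
          = ∏ d ∈ P, H S d (x d.1) (x d.2)
            + (W e (x e.1) (x e.2) - F e (x e.1) (x e.2)) * (a x * b x) := by
        intro x
        simp only [a, b]
        rw [prod_filter_mul_prod_filter_not, ← mul_prod_erase P _ heP, ← mul_prod_erase P _ heP]
        have : ∏ d ∈ P.erase e, H (insert e S) d (x d.1) (x d.2)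
            = ∏ d ∈ P.erase e, H S d (x d.1) (x d.2) := by
          refine prod_congr rfl fun d hd => ?_
          simp only [H, mem_insert, ne_of_mem_erase hd, false_or]
        rw [this]
        simp only [H, mem_insert_self, if_true, heS, if_false]
        ring
      have hb : ∀ x x', (∀ l, l ≠ e.1 → x l = x' l) → b x = b x' := by
        intro x x' h
        refine prod_congr rfl fun d hd => ?_
        rw [mem_filter, mem_erase] at hd
        have h1 := hP e heP
        have h2 := hP d hd.1.2
        have h3 : d.1 ≠ e.1 ∧ d.2 ≠ e.1 := by
          constructor
          · intro h4
            have h5 : d.2 ≠ e.2 := fun h5 => hd.1.1 (Prod.ext h4 h5)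
            have h6 : d.1 ≠ e.2 := by rw [h4]; exact h1.ne
            exact hd.2 ⟨h6, h5⟩
          · intro h4
            refine hd.2 ⟨?_, by rw [h4]; exact h1.ne⟩
            rw [h4] at h2
            exact (h2.trans h1).ne
        rw [h _ h3.1, h _ h3.2]
      have ha : ∀ x x', (∀ l, l ≠ e.2 → x l = x' l) → a x = a x' := by
        intro x x' h
        refine prod_congr rfl fun d hd => ?_
        rw [mem_filter] at hd
        rw [h _ hd.2.1, h _ hd.2.2]
      have hstep := sum_pair_mul_le (hcut e) (hP e heP).ne ha hb
        (fun x => prod_nonneg fun d _ => hH0 _ _ _ _)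
        (fun x => prod_le_one (fun d _ => hH0 _ _ _ _) fun d _ => hH1 _ _ _ _)
        (fun x => prod_nonneg fun d _ => hH0 _ _ _ _)
        (fun x => prod_le_one (fun d _ => hH0 _ _ _ _) fun d _ => hH1 _ _ _ _)
      simp only [split, sum_add_distrib, card_insert_of_notMem heS]
      push_cast
      linarith
  have h := main P subset_rfl
  have e : ∀ x : Fin k → V, ∏ e ∈ P, H P e (x e.1) (x e.2) = ∏ e ∈ P, W e (x e.1) (x e.2) :=
    fun x => prod_congr rfl fun e he => by simp only [H, he, if_true]
  simpa only [e] using h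

end Counting

/-! ### Ordered pairs -/

section Pairs

/-- The pairs `(i, j)` with `i < j`. -/
def ltPairs (m : ℕ) : Finset (Fin m × Fin m) := {z | z.1 < z.2}

lemma sum_sum_eq_ltPairs {m : ℕ} {g : Fin m → Fin m → ℝ} (hg : ∀ i j, g i j = g j i) :
    ∑ i, ∑ j, g i j = 2 * ∑ z ∈ ltPairs m, g z.1 z.2 + ∑ i, g i i := by
  have e : ∀ i j, g i j = (if i < j then g i j else 0) + (if j < i then g j i else 0)
      + (if i = j then g i i else 0) := by
    intro i j
    rcases lt_trichotomy i j with h | h | h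
    · simp [h, h.ne, h.asymm]
    · simp [h]
    · simp [h, h.ne', h.asymm, hg i j]
  calc ∑ i, ∑ j, g i j = ∑ i, ∑ j, ((if i < j then g i j else 0) + (if j < i then g j i else 0)
      + (if i = j then g i i else 0)) :=
        sum_congr rfl fun i _ => sum_congr rfl fun j _ => e i j
    _ = _ := by
        simp only [sum_add_distrib, sum_ite_eq, mem_univ, if_true]
        rw [sum_comm (f := fun i j => if j < i then g j i else 0), ltPairs, sum_filter,
          Fintype.sum_prod_type, two_mul]

lemma card_ltPairs (m : ℕ) : (#(ltPairs m) : ℝ) = m * (m - 1) / 2 := by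
  have h := sum_sum_eq_ltPairs (m := m) (g := fun _ _ => (1 : ℝ)) (fun _ _ => rfl)
  simp at h
  linarith

lemma sum_edgeSet {n : ℕ} (G : SimpleGraph (Fin n)) [Fintype G.edgeSet] [DecidableRel G.Adj]
    (h : Sym2 (Fin n) → ℝ) :
    ∑ e : G.edgeSet, h e = ∑ z ∈ ltPairs n, if G.Adj z.1 z.2 then h s(z.1, z.2) else 0 := by
  classical
  have h1 := sum_sym2_filter_not_isDiag (univ : Finset (Fin n))
    (fun e => if e ∈ G.edgeSet then h e else 0)
  have h2 : ∑ e : G.edgeSet, h e = ∑ e : Sym2 (Fin n), if e ∈ G.edgeSet then h e else 0 := by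
    rw [← sum_filter]
    exact (sum_subtype _ (by simp) _).symm
  have h3 : (univ : Finset (Fin n)).offDiag.filter (fun z => z.1 < z.2) = ltPairs n := by
    ext z
    simp only [ltPairs, mem_filter, mem_offDiag, mem_univ, true_and]
    exact ⟨fun h => h.2, fun h => ⟨h.ne, h⟩⟩
  rw [h3] at h1
  rw [h2, ← sum_filter_add_sum_filter_not _ (fun e : Sym2 (Fin n) => ¬ e.IsDiag)]
  rw [sym2_univ] at h1
  rw [h1]
  have h4 : ∑ e : Sym2 (Fin n) with ¬ ¬ e.IsDiag, (if e ∈ G.edgeSet then h e else 0) = 0 := by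
    refine sum_eq_zero fun e he => if_neg fun h' => ?_
    rw [mem_filter, not_not] at he
    exact G.not_isDiag_of_mem_edgeSet h' he.2
  rw [h4, add_zero]
  exact sum_congr rfl fun z _ => by simp only [SimpleGraph.mem_edgeSet]

end Pairs

/-! ### Supersaturation -/

section Supersaturation

variable {V : Type*} [Fintype V] {k s : ℕ}

/-- The maps `x` from the vertices of `K_k` such that each pair `ij` is coloured by an element of
the set `φ (x i) (x j)`. -/
def copies (σ : SimpleGraph.TopEdgeLabeling (Fin k) (Fin s)) (φ : V → V → Finset (Fin s)) :
    Finset (Fin k → V) :=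
  {x | ∀ (i j : Fin k) (hij : i ≠ j), σ.get i j hij ∈ φ (x i) (x j)}

lemma log_card_le (A : Finset (Fin s)) : Real.log (#A : ℝ) ≤ Real.log s := by
  rcases Nat.eq_zero_or_pos #A with h | h
  · rw [h, Nat.cast_zero, Real.log_zero]
    exact Real.log_natCast_nonneg s
  · exact Real.log_le_log (Nat.cast_pos.2 h) (Nat.cast_le.2 (card_finset_fin_le A))

/-- A free set colouring on `m` points, with uniform weights `1 / m`, is itself a feasible triple.
-/
lemma two_mul_sum_log_le {X : Family k s} {m : ℕ} (hm : 0 < m) {Q : ℝ}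
    (hQ : ∀ T ∈ feas X 0, T.q ≤ Q) (φ : Fin m → Fin m → Finset (Fin s))
    (hφ : ∀ i j, φ i j = φ j i)
    (hfree : ∀ σ ∈ X, ∀ ψ : Fin k ↪ Fin m, ⇑ψ ∉ copies σ φ) :
    2 * ∑ z ∈ ltPairs m, Real.log (#(φ z.1 z.2) : ℝ) ≤ Q * (m : ℝ) ^ 2 := by
  have hm' : (0 : ℝ) < m := Nat.cast_pos.2 hm
  let T : Triple s :=
    { r := m
      φ := SimpleGraph.EdgeLabeling.mk (fun i j _ => φ i j) (fun i j _ => hφ j i)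
      α := fun _ => (m : ℝ)⁻¹ }
  have hT : T ∈ feas X 0 := by
    refine ⟨⟨?_, fun _ _ _ => Nat.zero_le _⟩, fun _ => by positivity, ?_⟩
    · rintro σ hσ ⟨ψ, hψ⟩
      refine hfree σ hσ ψ ?_
      simp only [copies, mem_filter, mem_univ, true_and]
      exact fun i j hij => hψ i j hij
    · simp [T, hm'.ne']
  have h := hQ T hT
  have e : T.q = 2 * ((m : ℝ)⁻¹ ^ 2 * ∑ z ∈ ltPairs m, Real.log (#(φ z.1 z.2) : ℝ)) := by
    rw [Triple.q, ltPairs, sum_filter, Fintype.sum_prod_type]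
    congr 1
    rw [mul_sum]
    refine sum_congr rfl fun i _ => ?_
    rw [mul_sum]
    refine sum_congr rfl fun j _ => ?_
    by_cases hij : i < j
    · rw [dif_pos hij, if_pos hij]
      simp only [T, SimpleGraph.EdgeLabeling.get_mk]
      ring
    · rw [dif_neg hij, if_neg hij, mul_zero]
  rw [e] at h
  have h' := mul_le_mul_of_nonneg_right h (sq_nonneg (m : ℝ))
  have e' : (m : ℝ)⁻¹ ^ 2 * (m : ℝ) ^ 2 = 1 := by
    rw [← mul_pow, inv_mul_cancel₀ hm'.ne', one_pow]
  linear_combination h' - 2 * (∑ z ∈ ltPairs m, Real.log (#(φ z.1 z.2) : ℝ)) * e'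

/-- A set colouring with few copies of the members of `X` cannot beat the optimum by much. -/
theorem sum_log_le_of_few_copies [Nonempty V] {X : Family k s} {m : ℕ} (hm : 0 < m) {Q : ℝ}
    (hQ : ∀ T ∈ feas X 0, T.q ≤ Q) (hQ0 : 0 ≤ Q) (φ : V → V → Finset (Fin s))
    (hφ : ∀ x y, φ x y = φ y x) {η : ℝ} (hη : 0 ≤ η)
    (hfew : ∀ σ ∈ X, (#(copies σ φ) : ℝ) ≤ η * (Fintype.card V : ℝ) ^ k) :
    ((m : ℝ) - 1) * ∑ x, ∑ y, Real.log (#(φ x y) : ℝ) ≤ (Fintype.card V : ℝ) ^ 2 * (m *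
      (Q + Real.log s * (Fintype.card (SimpleGraph.TopEdgeLabeling (Fin k) (Fin s)) *
        (Fintype.card (Fin k ↪ Fin m) * η)))) := by
  classical
  set n : ℝ := (Fintype.card V : ℝ) with hn
  have hn0 : 0 < n := Nat.cast_pos.2 Fintype.card_pos
  have hm' : (0 : ℝ) < m := Nat.cast_pos.2 hm
  have hs0 : 0 ≤ Real.log (s : ℝ) := Real.log_natCast_nonneg s
  let L : V → V → ℝ := fun x y => Real.log (#(φ x y) : ℝ)
  let ind : SimpleGraph.TopEdgeLabeling (Fin k) (Fin s) → (Fin k → V) → ℝ := fun σ x =>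
    if σ ∈ X ∧ x ∈ copies σ φ then 1 else 0
  have hind0 : ∀ σ x, 0 ≤ ind σ x := by intro σ x; simp only [ind]; split_ifs <;> norm_num
  -- Bound for one sample `y`, drawn with repetition allowed. If the induced set colouring is free,
  -- `Q` bounds it; otherwise the trivial bound `log s` per pair is charged to a forbidden copy,
  -- which makes the indicator sum at least 1.
  have point : ∀ y : Fin m → V, 2 * ∑ z ∈ ltPairs m, L (y z.1) (y z.2) ≤
      (m : ℝ) ^ 2 * (Q + Real.log s * ∑ σ, ∑ ψ : Fin k ↪ Fin m, ind σ (y ∘ ψ)) := by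
    intro y
    have hsum0 : 0 ≤ ∑ σ, ∑ ψ : Fin k ↪ Fin m, ind σ (y ∘ ψ) :=
      sum_nonneg fun _ _ => sum_nonneg fun _ _ => hind0 _ _
    by_cases hfree : ∀ σ ∈ X, ∀ ψ : Fin k ↪ Fin m, ⇑ψ ∉ copies σ (fun i j => φ (y i) (y j))
    · have := two_mul_sum_log_le hm hQ (fun i j => φ (y i) (y j)) (fun i j => hφ _ _) hfree
      refine this.trans ?_
      rw [mul_comm]
      refine mul_le_mul_of_nonneg_left ?_ (sq_nonneg _)
      have := mul_nonneg hs0 hsum0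
      linarith
    · push Not at hfree
      obtain ⟨σ, hσ, ψ, hψ⟩ := hfree
      have h1 : (1 : ℝ) ≤ ∑ σ, ∑ ψ : Fin k ↪ Fin m, ind σ (y ∘ ψ) := by
        have hone : ind σ (y ∘ ψ) = 1 := by
          refine if_pos ⟨hσ, ?_⟩
          simp only [copies, mem_filter, mem_univ, true_and] at hψ ⊢
          exact hψ
        rw [← hone]
        exact (single_le_sum (f := fun ψ : Fin k ↪ Fin m => ind σ (y ∘ ψ))
          (fun _ _ => hind0 _ _) (mem_univ ψ)).trans
          (single_le_sum (f := fun σ => ∑ ψ : Fin k ↪ Fin m, ind σ (y ∘ ψ))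
            (fun _ _ => sum_nonneg fun _ _ => hind0 _ _) (mem_univ σ))
      have h2 : ∑ z ∈ ltPairs m, L (y z.1) (y z.2) ≤ #(ltPairs m) * Real.log s := by
        rw [← nsmul_eq_mul]
        exact sum_le_card_nsmul _ _ _ fun z _ => log_card_le _
      rw [card_ltPairs] at h2
      have h3 : Real.log s ≤ Real.log s * ∑ σ, ∑ ψ : Fin k ↪ Fin m, ind σ (y ∘ ψ) :=
        le_mul_of_one_le_right hs0 h1
      have h4 : (m : ℝ) ^ 2 * Real.log s ≤
          (m : ℝ) ^ 2 * (Q + Real.log s * ∑ σ, ∑ ψ : Fin k ↪ Fin m, ind σ (y ∘ ψ)) :=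
        mul_le_mul_of_nonneg_left (by linarith) (sq_nonneg _)
      nlinarith [mul_nonneg hm'.le hs0]
  have hpair : ∀ z ∈ ltPairs m, n ^ 2 * ∑ y : Fin m → V, L (y z.1) (y z.2) =
      n ^ m * ∑ x, ∑ y, L x y := by
    intro z hz
    have hz' : z.1 ≠ z.2 := (mem_filter.1 hz).2.ne
    have h := sum_comp_embedding_card (V := V) (injective_pair hz') (fun x => L (x 0) (x 1))
    rw [sum_pair] at h
    simpa using h
  have hbad : ∀ σ, ∀ ψ : Fin k ↪ Fin m, ∑ y : Fin m → V, ind σ (y ∘ ψ) ≤ n ^ m * η := by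
    intro σ ψ
    have h := sum_comp_embedding_card (V := V) ψ.injective (ind σ)
    simp only [Fintype.card_fin, ← hn] at h
    have hle : ∑ x, ind σ x ≤ η * n ^ k := by
      by_cases hσ : σ ∈ X
      · refine le_trans (le_of_eq ?_) (hfew σ hσ)
        simp [ind, hσ]
      · simp only [ind, hσ, false_and, if_false, sum_const_zero]
        positivity
    refine le_of_mul_le_mul_left ?_ (pow_pos hn0 k)
    rw [h]
    calc n ^ m * ∑ x, ind σ x ≤ n ^ m * (η * n ^ k) :=
          mul_le_mul_of_nonneg_left hle (by positivity)
      _ = n ^ k * (n ^ m * η) := by ring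
  -- Averaging over all samples: each pair of sample points is uniform on `V × V`, and each embedded
  -- `k`-tuple is uniform on `V ^ k`, hence is a copy of a given member of `X` with probability at
  -- most `η`.
  have total := sum_le_sum fun (y : Fin m → V) (_ : y ∈ univ) => point y
  have lhs : n ^ 2 * ∑ y : Fin m → V, 2 * ∑ z ∈ ltPairs m, L (y z.1) (y z.2)
      = n ^ m * (m * (m - 1) * ∑ x, ∑ y, L x y) := by
    rw [← mul_sum, sum_comm, mul_left_comm, mul_sum, sum_congr rfl hpair, sum_const,
      nsmul_eq_mul, card_ltPairs]
    ring
  have rhs : ∑ y : Fin m → V,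
      (m : ℝ) ^ 2 * (Q + Real.log s * ∑ σ, ∑ ψ : Fin k ↪ Fin m, ind σ (y ∘ ψ)) ≤
      n ^ m * ((m : ℝ) ^ 2 *
        (Q + Real.log s * (Fintype.card (SimpleGraph.TopEdgeLabeling (Fin k) (Fin s)) *
        (Fintype.card (Fin k ↪ Fin m) * η)))) := by
    rw [← mul_sum, sum_add_distrib, ← mul_sum, sum_comm]
    have h1 : ∑ σ, ∑ y : Fin m → V, ∑ ψ : Fin k ↪ Fin m, ind σ (y ∘ ψ) ≤
        Fintype.card (SimpleGraph.TopEdgeLabeling (Fin k) (Fin s)) *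
          (Fintype.card (Fin k ↪ Fin m) * (n ^ m * η)) := by
      rw [← nsmul_eq_mul, ← nsmul_eq_mul, ← card_univ, ← card_univ]
      refine sum_le_card_nsmul _ _ _ fun σ _ => ?_
      rw [sum_comm]
      exact sum_le_card_nsmul _ _ _ fun ψ _ => hbad σ ψ
    have h2 : ∑ _y : Fin m → V, Q = n ^ m * Q := by simp [hn]
    rw [h2]
    have h3 := mul_le_mul_of_nonneg_left h1 hs0
    have h4 : (m : ℝ) ^ 2 * (n ^ m * Q + Real.log s *
        ∑ σ, ∑ y : Fin m → V, ∑ ψ : Fin k ↪ Fin m, ind σ (y ∘ ψ)) ≤ (m : ℝ) ^ 2 * (n ^ m * Q +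
        Real.log s * (Fintype.card (SimpleGraph.TopEdgeLabeling (Fin k) (Fin s)) *
          (Fintype.card (Fin k ↪ Fin m) * (n ^ m * η)))) :=
      mul_le_mul_of_nonneg_left (by linarith) (sq_nonneg _)
    refine h4.trans (le_of_eq (by ring))
  have final := mul_le_mul_of_nonneg_left (total.trans rhs) (sq_nonneg n)
  rw [lhs] at final
  refine le_of_mul_le_mul_left ?_ (mul_pos (pow_pos hn0 m) hm')
  refine le_trans (le_of_eq ?_) (final.trans (le_of_eq ?_))
  · simp only [L]
    ring
  · ring

end Supersaturation

/-! ### Templates of free colourings -/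

section Template

variable {k s : ℕ}

/-- The indicator function of the edges of colour `c`. -/
def colourIndicator {V : Type*} {G : SimpleGraph V} (χ : G.EdgeLabeling (Fin s)) (c : Fin s)
    (x y : V) : ℝ :=
  open Classical in if ∃ h : G.Adj x y, χ.get x y h = c then 1 else 0

lemma colourIndicator_mem_Icc {V : Type*} {G : SimpleGraph V} (χ : G.EdgeLabeling (Fin s))
    (c : Fin s) (x y : V) : 0 ≤ colourIndicator χ c x y ∧ colourIndicator χ c x y ≤ 1 := by
  unfold colourIndicator
  split_ifs <;> norm_num

lemma colourIndicator_comm {V : Type*} {G : SimpleGraph V} (χ : G.EdgeLabeling (Fin s))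
    (c : Fin s) (x y : V) : colourIndicator χ c x y = colourIndicator χ c y x := by
  have : (∃ h : G.Adj x y, χ.get x y h = c) ↔ ∃ h : G.Adj y x, χ.get y x h = c :=
    ⟨fun ⟨h, e⟩ => ⟨h.symm, by rw [← e, χ.get_comm]⟩, fun ⟨h, e⟩ => ⟨h.symm, by
      rw [← e, χ.get_comm]⟩⟩
  classical exact if_congr this rfl rfl

/-- Non-injective maps contribute nothing either, since the graph has no loops; so the absence of
injective copies kills the whole homomorphism sum. -/
lemma sum_prod_colourIndicator_eq_zero {V : Type*} [Fintype V] {G : SimpleGraph V}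
    {χ : G.EdgeLabeling (Fin s)} {σ : SimpleGraph.TopEdgeLabeling (Fin k) (Fin s)}
    (hχ : ¬ ContainsCopy χ σ) {c : Fin k × Fin k → Fin s}
    (hc : ∀ i j (hij : i ≠ j), c (i, j) = σ.get i j hij) :
    ∑ x : Fin k → V, ∏ e ∈ ltPairs k, colourIndicator χ (c e) (x e.1) (x e.2) = 0 := by
  classical
  refine sum_eq_zero fun x _ => ?_
  by_contra hne
  rw [← ne_eq, prod_ne_zero_iff] at hne
  have hlt : ∀ i j (hij : i < j), ∃ h : G.Adj (x i) (x j), χ.get _ _ h = σ.get i j hij.ne := by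
    intro i j hij
    have h := hne (i, j) (by simpa [ltPairs] using hij)
    unfold colourIndicator at h
    rw [hc i j hij.ne] at h
    by_contra h'
    exact h (if_neg h')
  have hall : ∀ i j (hij : i ≠ j), ∃ h : G.Adj (x i) (x j), χ.get _ _ h = σ.get i j hij := by
    intro i j hij
    rcases lt_or_gt_of_ne hij with h | h
    · exact hlt i j h
    · obtain ⟨h1, h2⟩ := hlt j i h
      exact ⟨h1.symm, by rw [χ.get_comm, h2, σ.get_comm]⟩
  refine hχ ⟨⟨x, fun i j hx => ?_⟩, hall⟩
  by_contra hij
  obtain ⟨h, _⟩ := hall i j hij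
  rw [hx] at h
  exact G.irrefl h

lemma card_copies_mul_pow_le {V : Type*} [Fintype V] {φ : V → V → Finset (Fin s)}
    {σ : SimpleGraph.TopEdgeLabeling (Fin k) (Fin s)} {c : Fin k × Fin k → Fin s}
    (hc : ∀ i j (hij : i ≠ j), c (i, j) = σ.get i j hij) {δ : ℝ} (hδ : 0 ≤ δ)
    {W : Fin s → V → V → ℝ} (hW0 : ∀ c x y, 0 ≤ W c x y)
    (hW : ∀ c x y, c ∈ φ x y → δ ≤ W c x y) :
    (#(copies σ φ) : ℝ) * δ ^ #(ltPairs k) ≤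
      ∑ x : Fin k → V, ∏ e ∈ ltPairs k, W (c e) (x e.1) (x e.2) := by
  rw [← nsmul_eq_mul]
  refine le_trans (card_nsmul_le_sum _ _ _ fun x hx => ?_)
    (sum_le_univ_sum_of_nonneg fun x => prod_nonneg fun _ _ => hW0 _ _ _)
  rw [← prod_const]
  refine prod_le_prod (fun _ _ => hδ) fun e he => hW _ _ _ ?_
  have hlt : e.1 < e.2 := (mem_filter.1 he).2
  have := (mem_filter.1 hx).2 e.1 e.2 hlt.ne
  rwa [← hc e.1 e.2 hlt.ne] at this

/-- An edge whose colour is off the template lies in a cell where that colour has density at most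
`δ`; for each colour such cells hold at most `δ * n ^ 2` of its ordered pairs. -/
lemma card_bad_le {V : Type*} [Fintype V] [DecidableEq V] {G : SimpleGraph V} [Fintype G.edgeSet]
    (χ : G.edgeSet → Fin s) (B : Sym2 V → Finset (Fin s)) {δ : ℝ} (p : V → ℕ)
    (hB : ∀ c x y, c ∉ B s(x, y) → blockAvg p (colourIndicator (G := G) χ c) (p x) (p y) ≤ δ)
    (hδ : 0 ≤ δ) :
    (#{e : G.edgeSet | χ e ∉ B e} : ℝ) ≤ s * (δ * (Fintype.card V : ℝ) ^ 2) := by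
  classical
  let χ' : G.EdgeLabeling (Fin s) := χ
  let W : Fin s → ℕ × ℕ → ℝ := fun c => fiberAvg (fun z : V × V => (p z.1, p z.2))
    (fun z => colourIndicator χ' c z.1 z.2)
  let I : Fin s → ℕ × ℕ → ℝ := fun c ab => if W c ab ≤ δ then 1 else 0
  have h1 : #{e : G.edgeSet | χ e ∉ B e} ≤
      #{z : V × V | ∃ h : G.Adj z.1 z.2, χ'.get z.1 z.2 h ∉ B s(z.1, z.2)} := by
    -- Each edge is sent to a chosen orientation, so that the count can be made over ordered pairs.
    refine card_le_card_of_injOn (fun e => Quot.out e.1) ?_ ?_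
    · rintro ⟨e, he⟩ h
      have h' : χ ⟨e, he⟩ ∉ B e := by simpa using h
      have hout : s((Quot.out e).1, (Quot.out e).2) = e := Quot.out_eq e
      simp only [coe_filter, mem_univ, true_and, Set.mem_ofPred_eq]
      have htr : ∀ e' (_ : e' = e) (he' : e' ∈ G.edgeSet), χ ⟨e', he'⟩ ∉ B e' := by
        rintro _ rfl _
        exact h'
      refine ⟨by rw [← SimpleGraph.mem_edgeSet, hout]; exact he, ?_⟩
      exact htr _ hout _
    · intro e _ e' _ h
      exact Subtype.ext
        ((Quot.out_eq e.1).symm.trans ((congrArg (Quot.mk _) h).trans (Quot.out_eq e'.1)))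
  have h2 : (#{z : V × V | ∃ h : G.Adj z.1 z.2, χ'.get z.1 z.2 h ∉ B s(z.1, z.2)} : ℝ) ≤
      ∑ z : V × V, ∑ c, colourIndicator χ' c z.1 z.2 * I c (p z.1, p z.2) := by
    rw [card_filter, Nat.cast_sum]
    refine sum_le_sum fun z _ => ?_
    have hnn : ∀ c, 0 ≤ colourIndicator χ' c z.1 z.2 * I c (p z.1, p z.2) := fun c =>
      mul_nonneg (colourIndicator_mem_Icc χ' c _ _).1 (by simp only [I]; split_ifs <;> norm_num)
    split_ifs with h
    · obtain ⟨hadj, hz⟩ := h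
      have h3 : colourIndicator χ' (χ'.get z.1 z.2 hadj) z.1 z.2 = 1 := if_pos ⟨hadj, rfl⟩
      have h4 : I (χ'.get z.1 z.2 hadj) (p z.1, p z.2) = 1 := if_pos (hB _ _ _ hz)
      refine le_trans ?_ (single_le_sum (fun c _ => hnn c) (mem_univ (χ'.get z.1 z.2 hadj)))
      rw [h3, h4]
      norm_num
    · rw [Nat.cast_zero]
      exact sum_nonneg fun c _ => hnn c
  refine (Nat.cast_le.2 h1).trans (h2.trans ?_)
  rw [sum_comm]
  calc ∑ c, ∑ z : V × V, colourIndicator χ' c z.1 z.2 * I c (p z.1, p z.2)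
      = ∑ c, ∑ z : V × V, W c (p z.1, p z.2) * I c (p z.1, p z.2) :=
        sum_congr rfl fun c _ => (sum_fiberAvg_mul (fun z : V × V => (p z.1, p z.2))
          (fun z => colourIndicator χ' c z.1 z.2) (I c)).symm
    _ ≤ ∑ _c : Fin s, ∑ _z : V × V, δ := by
        refine sum_le_sum fun c _ => sum_le_sum fun z _ => ?_
        simp only [I]
        split_ifs with h
        · rwa [mul_one]
        · rwa [mul_zero]
    _ = s * (δ * (Fintype.card V : ℝ) ^ 2) := by
        simp only [sum_const, card_univ, Fintype.card_prod, Fintype.card_fin, nsmul_eq_mul]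
        push_cast
        ring

/-- The set of colours on an unordered pair given by a labelling `p` of the vertices and a
symmetric template on the labels. -/
def templateSet {V : Type*} {M : ℕ} (p : V → Fin M) (T : Fin M → Fin M → Finset (Fin s))
    (hT : ∀ a b, T a b = T b a) : Sym2 V → Finset (Fin s) :=
  Sym2.lift ⟨fun x y => T (p x) (p y), fun _ _ => hT _ _⟩

/-- Every free colouring follows, up to few edges, a template of bounded complexity with few copies
of the members of the forbidden family. -/
theorem exists_template (hs : 0 < s) (X : Family k s) {δ η : ℝ} (hδ : 0 < δ) (hη : 0 < η) :
    ∃ M : ℕ, ∀ (V : Type) [Fintype V] [DecidableEq V] [Nonempty V] (G : SimpleGraph V)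
      [Fintype G.edgeSet] (χ : G.edgeSet → Fin s), IsFree X (G := G) χ →
      ∃ (p : V → Fin M) (T : Fin M → Fin M → Finset (Fin s)) (hT : ∀ a b, T a b = T b a),
        (∀ σ ∈ X, (#(copies σ fun x y => T (p x) (p y)) : ℝ) ≤ η * (Fintype.card V : ℝ) ^ k) ∧
        (#{e : G.edgeSet | χ e ∉ templateSet p T hT e} : ℝ) ≤
          s * (δ * (Fintype.card V : ℝ) ^ 2) := by
  classical
  set N := #(ltPairs k)
  have hN : (0 : ℝ) < (N : ℝ) + 1 := by positivity
  -- Each template copy weighs at least `δ ^ N`, while the counting error is `N * ε * n ^ k`; this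
  -- `ε` makes the ratio at most `η * n ^ k`. The `+ 1` avoids division by zero.
  obtain ⟨M, hM⟩ := weak_regularity s (ε := η * δ ^ N / (N + 1)) (by positivity)
  refine ⟨M, fun V _ _ _ G _ χ hχ => ?_⟩
  let χ' : G.EdgeLabeling (Fin s) := χ
  obtain ⟨p, hpM, hp⟩ := hM V (colourIndicator χ') (fun c x y => (colourIndicator_mem_Icc χ' c x y).1)
    (fun c x y => (colourIndicator_mem_Icc χ' c x y).2)
  let T : Fin M → Fin M → Finset (Fin s) := fun a b =>
    {c | δ < blockAvg p (colourIndicator χ' c) a b}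
  have hT : ∀ a b, T a b = T b a := by
    intro a b
    ext c
    simp only [T, mem_filter, mem_univ, true_and,
      blockAvg_comm p (colourIndicator_comm χ' c) (a : ℕ) b]
  have hW := fun c x y => blockAvg_mem_Icc p (fun x y => (colourIndicator_mem_Icc χ' c x y).1)
    (fun x y => (colourIndicator_mem_Icc χ' c x y).2) (p x) (p y)
  refine ⟨fun x => ⟨p x, hpM x⟩, T, hT, fun σ hσ => ?_, ?_⟩
  · let c : Fin k × Fin k → Fin s := fun e =>
      if h : e.1 ≠ e.2 then σ.get e.1 e.2 h else ⟨0, hs⟩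
    have hc : ∀ i j (hij : i ≠ j), c (i, j) = σ.get i j hij := fun i j hij => dif_pos hij
    have h1 := card_copies_mul_pow_le (φ := fun x y => T ⟨p x, hpM x⟩ ⟨p y, hpM y⟩) hc hδ.le
      (W := fun c x y => blockAvg p (colourIndicator χ' c) (p x) (p y))
      (fun c x y => (hW c x y).1) (fun c x y h => (mem_filter.1 h).2.le)
    have h2 := sum_prod_le_of_cut_le (ltPairs k) (fun e he => (mem_filter.1 he).2)
      (F := fun e => colourIndicator χ' (c e))
      (W := fun e x y => blockAvg p (colourIndicator χ' (c e)) (p x) (p y))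
      (ε := η * δ ^ N / (N + 1))
      (fun e x y => (colourIndicator_mem_Icc χ' _ x y).1)
      (fun e x y => (colourIndicator_mem_Icc χ' _ x y).2)
      (fun e x y => (hW _ x y).1) (fun e x y => (hW _ x y).2) (fun e A B => by
        have h := (abs_le.1 (hp (c e) A B)).1
        have e' : ∑ x ∈ A, ∑ y ∈ B, (blockAvg p (colourIndicator χ' (c e)) (p x) (p y)
            - colourIndicator χ' (c e) x y) = - ∑ x ∈ A, ∑ y ∈ B, (colourIndicator χ' (c e) x y
              - blockAvg p (colourIndicator χ' (c e)) (p x) (p y)) := by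
          simp only [← sum_neg_distrib, neg_sub]
        rw [e']
        linarith)
    rw [sum_prod_colourIndicator_eq_zero (hχ σ hσ) hc, zero_add] at h2
    have hδN : 0 < δ ^ N := pow_pos hδ N
    refine le_of_mul_le_mul_right (h1.trans (h2.trans ?_)) hδN
    have h3 : (N : ℝ) * (η * δ ^ N / (N + 1)) ≤ η * δ ^ N := by
      rw [mul_div_assoc', div_le_iff₀ hN]
      nlinarith [mul_pos hη hδN]
    calc (N : ℝ) * (η * δ ^ N / (N + 1) * (Fintype.card V : ℝ) ^ k)
        = (N : ℝ) * (η * δ ^ N / (N + 1)) * (Fintype.card V : ℝ) ^ k := by ring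
      _ ≤ η * δ ^ N * (Fintype.card V : ℝ) ^ k :=
          mul_le_mul_of_nonneg_right h3 (by positivity)
      _ = _ := by ring
  · refine card_bad_le χ _ p (fun c x y h => ?_) hδ.le
    simpa [templateSet, T] using h

end Template

/-! ### Counting colourings close to a template -/

section Count

/-- Exponential Markov inequality: giving each colouring the weight `exp (-l)` per deviating edge
makes the total weight factor over the edges. -/
lemma card_close_mul_exp_le {E : Type*} [Fintype E] [DecidableEq E] {s : ℕ}
    (B : E → Finset (Fin s)) (l m : ℝ) (hl : 0 ≤ l) :
    (#{χ : E → Fin s | (#{e | χ e ∉ B e} : ℝ) ≤ m} : ℝ) * Real.exp (-(l * m)) ≤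
      ∏ e, ((#(B e) : ℝ) + s * Real.exp (-l)) := by
  have h1 : ∏ e, ∑ c : Fin s, (if c ∉ B e then Real.exp (-l) else 1)
      = ∑ χ : E → Fin s, Real.exp (-(l * #{e | χ e ∉ B e})) := by
    rw [prod_univ_sum, Fintype.piFinset_univ]
    refine sum_congr rfl fun χ _ => ?_
    rw [prod_ite, prod_const, prod_const_one, mul_one, ← Real.exp_nat_mul]
    congr 1
    ring
  have h2 : ∀ e, ∑ c : Fin s, (if c ∉ B e then Real.exp (-l) else 1)
      ≤ (#(B e) : ℝ) + s * Real.exp (-l) := by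
    intro e
    calc ∑ c : Fin s, (if c ∉ B e then Real.exp (-l) else 1)
        ≤ ∑ c : Fin s, ((if c ∈ B e then 1 else 0) + Real.exp (-l)) := by
          refine sum_le_sum fun c _ => ?_
          have := Real.exp_pos (-l)
          split_ifs <;> first | contradiction | linarith
      _ = _ := by simp [sum_add_distrib]
  rw [← nsmul_eq_mul]
  refine le_trans ?_ (prod_le_prod (fun e _ => sum_nonneg fun c _ => ?_) fun e _ => h2 e)
  · rw [h1]
    refine le_trans (card_nsmul_le_sum _ _ _ fun χ hχ => ?_)
      (sum_le_univ_sum_of_nonneg fun χ => (Real.exp_pos _).le)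
    rw [Real.exp_le_exp]
    exact neg_le_neg (mul_le_mul_of_nonneg_left (mem_filter.1 hχ).2 hl)
  · split_ifs
    exacts [zero_le_one, (Real.exp_pos _).le]

lemma card_close_le {E : Type*} [Fintype E] [DecidableEq E] {s : ℕ}
    (B : E → Finset (Fin s)) (l m : ℝ) (hl : 0 ≤ l) :
    (#{χ : E → Fin s | (#{e | χ e ∉ B e} : ℝ) ≤ m} : ℝ) ≤
      Real.exp (l * m + Fintype.card E * (s * Real.exp (-l)) + ∑ e, Real.log (#(B e) : ℝ)) := by
  have h := card_close_mul_exp_le B l m hl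
  have h1 : ∀ e, (#(B e) : ℝ) + s * Real.exp (-l) ≤
      Real.exp (s * Real.exp (-l) + Real.log (#(B e) : ℝ)) := by
    intro e
    have ht : 0 ≤ s * Real.exp (-l) := by positivity
    have hexp := Real.add_one_le_exp (s * Real.exp (-l))
    -- An empty colour set is harmless thanks to `log 0 = 0`: the claim becomes `t ≤ exp t`.
    rcases Nat.eq_zero_or_pos #(B e) with h0 | h0
    · rw [h0, Nat.cast_zero, Real.log_zero]
      rw [add_zero]
      linarith
    · have h1 : (1 : ℝ) ≤ #(B e) := Nat.one_le_cast.2 h0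
      rw [Real.exp_add, Real.exp_log (by linarith)]
      nlinarith
  have h2 := h.trans (prod_le_prod (fun e _ => by positivity) fun e _ => h1 e)
  rw [← Real.exp_sum, sum_add_distrib, sum_const, nsmul_eq_mul, card_univ] at h2
  have h3 := mul_le_mul_of_nonneg_right h2 (Real.exp_pos (l * m)).le
  rw [mul_assoc, ← Real.exp_add, neg_add_cancel, Real.exp_zero, mul_one, ← Real.exp_add] at h3
  refine h3.trans (le_of_eq ?_)
  congr 1
  ring

end Count

/-! ### The upper bound -/

section Upper

variable {k s : ℕ}

lemma numFree_eq_card (X : Family k s) {V : Type*} [Fintype V] [DecidableEq V] (G : SimpleGraph V)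
    [Fintype G.edgeSet] [DecidablePred fun χ : G.edgeSet → Fin s => IsFree X (G := G) χ] :
    numFree X G = #{χ : G.edgeSet → Fin s | IsFree X (G := G) χ} :=
  Nat.subtype_card (p := fun χ : G.edgeSet → Fin s => IsFree X (G := G) χ) _ (by simp)

lemma sum_edgeSet_le {n : ℕ} (G : SimpleGraph (Fin n)) [Fintype G.edgeSet]
    {h : Sym2 (Fin n) → ℝ} (h0 : ∀ e, 0 ≤ h e) :
    ∑ e : G.edgeSet, h e ≤ (∑ x, ∑ y, h s(x, y)) / 2 := by
  classical
  have h1 := sum_sum_eq_ltPairs (g := fun x y => h s(x, y)) (fun x y => by rw [Sym2.eq_swap])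
  have h2 : 0 ≤ ∑ x, h s(x, x) := sum_nonneg fun x _ => h0 _
  rw [sum_edgeSet]
  have h3 : ∑ z ∈ ltPairs n, (if G.Adj z.1 z.2 then h s(z.1, z.2) else 0) ≤
      ∑ z ∈ ltPairs n, h s(z.1, z.2) := by
    refine sum_le_sum fun z _ => ?_
    split_ifs
    exacts [le_rfl, h0 _]
  linarith

lemma card_edgeSet_le {n : ℕ} (G : SimpleGraph (Fin n)) [Fintype G.edgeSet] :
    (Fintype.card G.edgeSet : ℝ) ≤ (n : ℝ) ^ 2 := by
  have h := sum_edgeSet_le G (h := fun _ => 1) (fun _ => zero_le_one)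
  simp only [sum_const, card_univ, Fintype.card_fin, nsmul_eq_mul, mul_one] at h
  nlinarith [sq_nonneg (n : ℝ)]

theorem numFree_le (hs : 0 < s) {X : Family k s} {Q : ℝ} (hQ : ∀ T ∈ feas X 0, T.q ≤ Q)
    (hQ0 : 0 ≤ Q) {ζ : ℝ} (hζ : 0 < ζ) :
    ∃ A B : ℝ, 0 ≤ A ∧ 0 ≤ B ∧ ∀ n : ℕ, 0 < n → ∀ G : SimpleGraph (Fin n),
      (numFree X G : ℝ) ≤ Real.exp ((Q / 2 + ζ) * (n : ℝ) ^ 2 + A * n + B) := by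
  classical
  have hs' : (0 : ℝ) < s := Nat.cast_pos.2 hs
  -- The sample is large enough that the factor `m / (m - 1)` lost in supersaturation costs at most
  -- `ζ / 2` on `Q`.
  obtain ⟨m, hm2, hmQ⟩ : ∃ m : ℕ, 2 ≤ m ∧ Q ≤ ((m : ℝ) - 1) * (ζ / 2) := by
    obtain ⟨m, hm⟩ := exists_nat_gt (Q / (ζ / 2))
    refine ⟨m + 2, by omega, ?_⟩
    rw [div_lt_iff₀ (by positivity)] at hm
    push_cast
    nlinarith
  have hm2' : (2 : ℝ) ≤ m := by exact_mod_cast hm2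
  set κ : ℝ := Real.log s * (Fintype.card (SimpleGraph.TopEdgeLabeling (Fin k) (Fin s)) *
    Fintype.card (Fin k ↪ Fin m)) with hκ
  have hκ0 : 0 ≤ κ := mul_nonneg (Real.log_natCast_nonneg s) (by positivity)
  -- The constants share out `ζ`: `η` and `m` keep the log sum below `(Q + ζ) / 2`, while `l` and
  -- `δ` keep the slack factor and the deviating edges below `ζ / 4` each, all in units of `n ^ 2`.
  let η : ℝ := ζ / (4 * (κ + 1))
  have hη : 0 < η := by positivity
  have hκη : κ * η ≤ ζ / 4 := by
    simp only [η]
    rw [mul_div_assoc', div_le_div_iff₀ (by positivity) (by norm_num)]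
    nlinarith
  let l : ℝ := 4 * s / ζ
  have hl : 0 < l := by positivity
  have hl' : s * Real.exp (-l) ≤ ζ / 4 := by
    have h1 := Real.add_one_le_exp l
    have h2 : s = ζ / 4 * l := by simp only [l]; field_simp
    rw [Real.exp_neg, ← div_eq_mul_inv, div_le_iff₀ (Real.exp_pos l)]
    calc (s : ℝ) = ζ / 4 * l := h2
      _ ≤ ζ / 4 * Real.exp l := mul_le_mul_of_nonneg_left (by linarith) (by positivity)
  let δ : ℝ := ζ / (4 * (l * s + 1))
  have hδ : 0 < δ := by positivity
  have hlδ : l * (s * δ) ≤ ζ / 4 := by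
    simp only [δ]
    rw [← mul_assoc, mul_div_assoc', div_le_div_iff₀ (by positivity) (by norm_num)]
    nlinarith [mul_pos hl hs']
  obtain ⟨M, hM⟩ := exists_template hs X hδ hη
  let Tmpl := {T : Fin M → Fin M → Finset (Fin s) // ∀ a b, T a b = T b a}
  -- The number of choices is at most `M ^ n * card Tmpl`, and `a ≤ exp a` puts it in the exponent.
  refine ⟨M, Fintype.card Tmpl, by positivity, by positivity, fun n hn G => ?_⟩
  have : Nonempty (Fin n) := ⟨⟨0, hn⟩⟩
  let good : Finset ((Fin n → Fin M) × Tmpl) := univ.filter fun c =>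
    ∀ σ ∈ X, (#(copies σ fun x y => c.2.1 (c.1 x) (c.1 y)) : ℝ) ≤ η * (n : ℝ) ^ k
  let close : (Fin n → Fin M) × Tmpl → Finset (G.edgeSet → Fin s) := fun c =>
    univ.filter fun χ => (#{e : G.edgeSet | χ e ∉ templateSet c.1 c.2.1 c.2.2 e} : ℝ) ≤
      s * (δ * (n : ℝ) ^ 2)
  have hsub : (univ.filter fun χ : G.edgeSet → Fin s => IsFree X (G := G) χ) ⊆
      good.biUnion close := by
    intro χ hχ
    obtain ⟨p, T, hT, h1, h2⟩ := hM (Fin n) G χ (mem_filter.1 hχ).2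
    rw [Fintype.card_fin] at h1 h2
    exact mem_biUnion.2 ⟨(p, ⟨T, hT⟩), mem_filter.2 ⟨mem_univ _, h1⟩, mem_filter.2 ⟨mem_univ _, h2⟩⟩
  have hclose : ∀ c ∈ good, (#(close c) : ℝ) ≤ Real.exp ((Q / 2 + ζ) * (n : ℝ) ^ 2) := by
    intro c hc
    have h1 := card_close_le (fun e : G.edgeSet => templateSet c.1 c.2.1 c.2.2 e) l
      (s * (δ * (n : ℝ) ^ 2)) hl.le
    refine h1.trans (Real.exp_le_exp.2 ?_)
    have h2 := sum_edgeSet_le G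
      (h := fun e => Real.log (#(templateSet c.1 c.2.1 c.2.2 e) : ℝ))
      (fun e => Real.log_natCast_nonneg _)
    have h3 := sum_log_le_of_few_copies (m := m) (by omega) hQ hQ0
      (fun x y => c.2.1 (c.1 x) (c.1 y)) (fun x y => c.2.2 _ _) hη.le
      (by rw [Fintype.card_fin]; exact (mem_filter.1 hc).2)
    rw [Fintype.card_fin] at h3
    have h4 : ∑ x, ∑ y, Real.log (#(c.2.1 (c.1 x) (c.1 y)) : ℝ) ≤ (n : ℝ) ^ 2 * (Q + ζ) := by
      have hm1 : (0 : ℝ) < m - 1 := by linarith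
      refine le_of_mul_le_mul_left (h3.trans ?_) hm1
      rw [mul_left_comm ((m : ℝ) - 1)]
      refine mul_le_mul_of_nonneg_left ?_ (sq_nonneg (n : ℝ))
      have e : Real.log s * (Fintype.card (SimpleGraph.TopEdgeLabeling (Fin k) (Fin s)) *
        (Fintype.card (Fin k ↪ Fin m) * η)) = κ * η := by rw [hκ]; ring
      rw [e]
      have : (m : ℝ) * (κ * η) ≤ 2 * (m - 1) * (ζ / 4) :=
        mul_le_mul (by linarith) hκη (by positivity) (by linarith)
      linarith
    have h5 : ∑ e : G.edgeSet, Real.log (#(templateSet c.1 c.2.1 c.2.2 e) : ℝ) ≤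
        (n : ℝ) ^ 2 * (Q + ζ) / 2 := by
      refine h2.trans (div_le_div_of_nonneg_right ?_ zero_le_two)
      exact h4
    have h6 : (Fintype.card G.edgeSet : ℝ) * (s * Real.exp (-l)) ≤ (n : ℝ) ^ 2 * (ζ / 4) :=
      mul_le_mul (card_edgeSet_le G) hl' (by positivity) (by positivity)
    have h7 : l * (s * (δ * (n : ℝ) ^ 2)) ≤ ζ / 4 * (n : ℝ) ^ 2 := by
      have := mul_le_mul_of_nonneg_right hlδ (sq_nonneg (n : ℝ))
      linarith
    linarith
  have hgood : (#good : ℝ) ≤ Real.exp (M * n + Fintype.card Tmpl) := by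
    have h1 : #good ≤ M ^ n * Fintype.card Tmpl := by
      refine (card_le_univ _).trans (le_of_eq ?_)
      rw [Fintype.card_prod, Fintype.card_fun, Fintype.card_fin, Fintype.card_fin]
    have hexp : ∀ a : ℕ, (a : ℝ) ≤ Real.exp a := fun a => by
      have := Real.add_one_le_exp (a : ℝ)
      linarith
    calc (#good : ℝ) ≤ (M : ℝ) ^ n * Fintype.card Tmpl := by exact_mod_cast h1
      _ ≤ Real.exp M ^ n * Real.exp (Fintype.card Tmpl) :=
        mul_le_mul (pow_le_pow_left₀ (Nat.cast_nonneg _) (hexp M) n) (hexp _) (by positivity)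
          (by positivity)
      _ = Real.exp (M * n + Fintype.card Tmpl) := by
        rw [← Real.exp_nat_mul, ← Real.exp_add, mul_comm (n : ℝ)]
  rw [numFree_eq_card]
  calc (#{χ : G.edgeSet → Fin s | IsFree X (G := G) χ} : ℝ) ≤ ∑ c ∈ good, (#(close c) : ℝ) := by
        exact_mod_cast (card_le_card hsub).trans card_biUnion_le
    _ ≤ #good * Real.exp ((Q / 2 + ζ) * (n : ℝ) ^ 2) := by
        rw [← nsmul_eq_mul]
        exact sum_le_card_nsmul _ _ _ hclose
    _ ≤ Real.exp (M * n + Fintype.card Tmpl) * Real.exp ((Q / 2 + ζ) * (n : ℝ) ^ 2) :=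
        mul_le_mul_of_nonneg_right hgood (Real.exp_pos _).le
    _ = _ := by
        rw [← Real.exp_add]
        congr 1
        ring

end Upper

/-! ### The lower bound -/

section Lower

variable {k s : ℕ}

/-- The set of colours which `φ` gives to the pair `ij`, empty if `i = j`. -/
def SetColouring.colours {r : ℕ} (φ : SetColouring r s) (i j : Fin r) : Finset (Fin s) :=
  if h : i ≠ j then φ.get i j h else ∅

lemma SetColouring.colours_comm {r : ℕ} (φ : SetColouring r s) (i j : Fin r) :
    φ.colours i j = φ.colours j i := by
  unfold SetColouring.colours
  by_cases h : i = j
  · rw [h]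
  · rw [dif_pos h, dif_pos (Ne.symm h), φ.get_comm]

lemma Triple.q_eq (T : Triple s) :
    T.q = ∑ i, ∑ j, T.α i * T.α j * Real.log (#(T.φ.colours i j) : ℝ) := by
  rw [sum_sum_eq_ltPairs (fun i j => by rw [T.φ.colours_comm, mul_comm (T.α i)])]
  have h0 : ∑ i, T.α i * T.α i * Real.log (#(T.φ.colours i i) : ℝ) = 0 :=
    sum_eq_zero fun i _ => by simp [SetColouring.colours]
  rw [h0, add_zero, Triple.q, ltPairs, sum_filter, Fintype.sum_prod_type]
  congr 1
  refine sum_congr rfl fun i _ => sum_congr rfl fun j _ => ?_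
  by_cases hij : i < j
  · rw [dif_pos hij, if_pos hij, SetColouring.colours, dif_pos hij.ne]
  · rw [dif_neg hij, if_neg hij]

/-- First moment method with independent labels of distribution `α`. Distinct vertices are
independent, so the mean is exact and no rounding of `α * n` is needed. -/
lemma exists_blowup {r : ℕ} {α : Fin r → ℝ} (hα : α ∈ stdSimplex ℝ (Fin r))
    (L : Fin r → Fin r → ℝ) (n : ℕ) :
    ∃ π : Fin n → Fin r, (∑ i, ∑ j, α i * α j * L i j) * (n.choose 2 : ℝ) ≤
      ∑ z ∈ ltPairs n, L (π z.1) (π z.2) := by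
  set q := ∑ i, ∑ j, α i * α j * L i j
  by_contra! hcon
  have hpair : ∀ z ∈ ltPairs n,
      ∑ π : Fin n → Fin r, (∏ x, α (π x)) * L (π z.1) (π z.2) = q := by
    intro z hz
    have hz' : z.1 ≠ z.2 := (mem_filter.1 hz).2.ne
    have h := sum_comp_embedding α (injective_pair hz') (fun x => L (x 0) (x 1))
    simp only [hα.2, one_pow, one_mul, Fin.prod_univ_two] at h
    rw [sum_pair (fun i j => α i * α j * L i j)] at h
    simpa using h
  have hone : ∑ π : Fin n → Fin r, ∏ x, α (π x) = 1 := by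
    rw [sum_prod_eq_pow, hα.2, one_pow]
  have hw : ∀ π : Fin n → Fin r, 0 ≤ ∏ x, α (π x) := fun π => prod_nonneg fun x _ => hα.1 _
  have hzero : ∑ π : Fin n → Fin r, (∏ x, α (π x)) *
      (q * (n.choose 2 : ℝ) - ∑ z ∈ ltPairs n, L (π z.1) (π z.2)) = 0 := by
    simp only [mul_sub, sum_sub_distrib, mul_sum]
    rw [← sum_mul, hone, sum_comm, sum_congr rfl hpair, sum_const, nsmul_eq_mul, card_ltPairs,
      Nat.cast_choose_two]
    ring
  rw [sum_eq_zero_iff_of_nonneg fun π _ => mul_nonneg (hw π) (sub_nonneg.2 (hcon π).le)] at hzero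
  have hall : ∀ π : Fin n → Fin r, ∏ x, α (π x) = 0 := fun π =>
    (mul_eq_zero.1 (hzero π (mem_univ π))).resolve_right (sub_pos.2 (hcon π)).ne'
  simp [hall] at hone

/-- The graph joins the pairs with a nonempty colour set, so the omitted pairs contribute `log 0 =
0` and the sum over edges equals the sum over all pairs. -/
theorem exp_le_maxFree {X : Family k s} {t : ℕ} {T : Triple s} (hT : T ∈ feas X t) (n : ℕ) :
    Real.exp (T.q * (n.choose 2 : ℝ)) ≤ maxFree X n := by
  classical
  obtain ⟨π, hπ⟩ := exists_blowup hT.2 (fun i j => Real.log (#(T.φ.colours i j) : ℝ)) n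
  rw [← Triple.q_eq] at hπ
  let B : Sym2 (Fin n) → Finset (Fin s) :=
    Sym2.lift ⟨fun x y => T.φ.colours (π x) (π y), fun _ _ => T.φ.colours_comm _ _⟩
  let G : SimpleGraph (Fin n) :=
    { Adj := fun x y => (B s(x, y)).Nonempty
      symm := ⟨fun x y h => by rwa [Sym2.eq_swap]⟩
      loopless := ⟨fun x h => by simp [B, SetColouring.colours] at h⟩ }
  have hfree : ∀ χ : G.edgeSet → Fin s, (∀ e : G.edgeSet, χ e ∈ B e) → IsFree X (G := G) χ := by
    rintro χ hχ σ hσ ⟨ψ, hψ⟩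
    have hmem : ∀ i j (hij : i ≠ j), σ.get i j hij ∈ T.φ.colours (π (ψ i)) (π (ψ j)) := by
      intro i j hij
      obtain ⟨h, e⟩ := hψ i j hij
      rw [← e]
      exact hχ ⟨s(ψ i, ψ j), h⟩
    -- Vertices with the same label are not adjacent, so a forbidden copy in the blow-up projects
    -- injectively to the labels.
    have hne : ∀ i j (_ : i ≠ j), π (ψ i) ≠ π (ψ j) := by
      intro i j hij h
      have := hmem i j hij
      rw [h] at this
      simp [SetColouring.colours] at this
    refine hT.1.1 σ hσ ⟨⟨fun i => π (ψ i), fun i j h => ?_⟩, fun i j hij => ?_⟩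
    · by_contra hij
      exact hne i j hij h
    · have := hmem i j hij
      rwa [SetColouring.colours, dif_pos (hne i j hij)] at this
  have hcount : (∏ e : G.edgeSet, #(B e)) ≤ numFree X G := by
    rw [numFree_eq_card, ← Fintype.card_piFinset]
    refine card_le_card fun χ hχ => mem_filter.2 ⟨mem_univ _, hfree χ fun e => ?_⟩
    exact Fintype.mem_piFinset.1 hχ e
  have hpos : ∀ e : G.edgeSet, (0 : ℝ) < #(B e) := by
    rintro ⟨e, he⟩
    induction e using Sym2.inductionOn with
    | hf x y => exact Nat.cast_pos.2 (card_pos.2 he)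
  have hsum : ∑ z ∈ ltPairs n, Real.log (#(T.φ.colours (π z.1) (π z.2)) : ℝ) =
      ∑ e : G.edgeSet, Real.log (#(B e) : ℝ) := by
    rw [sum_edgeSet G (fun e => Real.log (#(B e) : ℝ))]
    refine sum_congr rfl fun z _ => ?_
    by_cases h : G.Adj z.1 z.2
    · exact (if_pos h).symm
    · have h' : T.φ.colours (π z.1) (π z.2) = ∅ := not_nonempty_iff_eq_empty.1 h
      rw [if_neg h, h', card_empty, Nat.cast_zero, Real.log_zero]
  calc Real.exp (T.q * (n.choose 2 : ℝ)) ≤ Real.exp (∑ e : G.edgeSet, Real.log (#(B e) : ℝ)) := by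
        rw [Real.exp_le_exp, ← hsum]
        exact hπ
    _ = ((∏ e : G.edgeSet, #(B e) : ℕ) : ℝ) := by
        rw [Real.exp_sum, Nat.cast_prod]
        exact prod_congr rfl fun e _ => Real.exp_log (hpos e)
    _ ≤ numFree X G := Nat.cast_le.2 hcount
    _ ≤ maxFree X n := Nat.cast_le.2 (le_sup' (fun G => numFree X G) (mem_univ G))

lemma Triple.q_nonneg {X : Family k s} {t : ℕ} {T : Triple s} (hT : T ∈ feas X t) : 0 ≤ T.q := by
  rw [Triple.q_eq]
  exact sum_nonneg fun i _ => sum_nonneg fun j _ =>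
    mul_nonneg (mul_nonneg (hT.2.1 i) (hT.2.1 j)) (Real.log_natCast_nonneg _)

end Lower

end

end GenER

theorem mainTheorem9 (s k : ℕ) (hs : 2 ≤ s) (hk : 3 ≤ k) (X : GenER.Family k s)
    (hX : (GenER.opt X 0).Nonempty) :
    ∃ f : ℕ → ℝ, f =o[Filter.atTop] (fun n : ℕ => (n : ℝ) ^ 2) ∧
      ∀ n : ℕ, (GenER.maxFree X n : ℝ) =
        Real.exp (GenER.optValue X 0 * (n.choose 2 : ℝ) + f n) := by
  obtain ⟨T, hT, hopt⟩ := hX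
  have hval : GenER.optValue X 0 = T.q :=
    IsGreatest.csSup_eq ⟨⟨T, hT, rfl⟩, by rintro _ ⟨T', hT', rfl⟩; exact hopt T' hT'⟩
  rw [hval]
  have hq0 := GenER.Triple.q_nonneg hT
  have hlow := GenER.exp_le_maxFree hT
  have hpos : ∀ n, (0 : ℝ) < GenER.maxFree X n := fun n => (Real.exp_pos _).trans_le (hlow n)
  refine ⟨fun n => Real.log (GenER.maxFree X n) - T.q * (n.choose 2 : ℝ), ?_, fun n => ?_⟩
  · rw [Asymptotics.isLittleO_iff]
    intro c hc
    obtain ⟨A, B, hA, hB, hup⟩ := GenER.numFree_le (X := X) (by omega) hopt hq0 (half_pos hc)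
    -- The linear terms to absorb are `A * n`, `B ≤ B * n` and the `q * n / 2` by which `q * n ^ 2 /
    -- 2` exceeds `q * n.choose 2`; the other `c / 2` is the `ζ` of the upper bound.
    obtain ⟨N, hN⟩ := exists_nat_ge ((A + B + T.q / 2) / (c / 2))
    filter_upwards [Filter.eventually_ge_atTop (max N 1)] with n hn
    have hn1 : 1 ≤ n := (le_max_right _ _).trans hn
    have hn1' : (1 : ℝ) ≤ n := by exact_mod_cast hn1
    have hnN : (A + B + T.q / 2) / (c / 2) ≤ n :=
      hN.trans (Nat.cast_le.2 ((le_max_left _ _).trans hn))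
    rw [div_le_iff₀ (by positivity)] at hnN
    have h0 : T.q * (n.choose 2 : ℝ) ≤ Real.log (GenER.maxFree X n) := by
      rw [Real.le_log_iff_exp_le (hpos n)]
      exact hlow n
    have h1 : Real.log (GenER.maxFree X n) ≤
        (T.q / 2 + c / 2) * (n : ℝ) ^ 2 + A * n + B := by
      rw [Real.log_le_iff_le_exp (hpos n)]
      obtain ⟨G, -, hG⟩ := Finset.exists_mem_eq_sup' Finset.univ_nonempty
        (fun G : SimpleGraph (Fin n) => GenER.numFree X G)
      rw [GenER.maxFree, hG]
      exact hup n hn1 G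
    rw [Real.norm_of_nonneg (sub_nonneg.2 h0), Real.norm_of_nonneg (sq_nonneg _),
      Nat.cast_choose_two]
    nlinarith
  · rw [add_sub_cancel, Real.exp_log (hpos n)]
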